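/- **Setting.** Let $m\ge 1$, let $X\subseteq\mathbb{R}^n$ be closed and convex, and let $f,g^{(1)},\dots,g^{(m)}:\mathbb{R}^n\to\mathbb{R}$. Consider the problem of minimizing $f(x)$ subject to $g^{(i)}(x)\le 0$ $(i=1,\dots,m)$ and $x\in X$ (no equality constraints), with optimal value $f^\star$. For $h:\mathbb{R}^n\to\mathbb{R}$, $\partial h(x)$ denotes the set of $q$ with $h(y)\ge h(x)+q^T(y-x)-o(\|y-x\|)$ as $y\to x$; this is the usual subdifferential if $h$ is convex, and $\{\nabla h(x)\}$ if $h$ is differentiable at $x$. Assume: * $\partial f(x)$ and $\partial g^{(i)}(x)$ are nonempty for all $x\in X$ and all $i$; * for some $\theta>0$, $f(y)-f(x)-q^T(y-x)\ge\frac{\theta}{2}\|x-y\|^2$ for all $x,y\in X$ and $q\in\partial f(x)$; * each $g^{(i)}$ is convex on $X$ and satisfies $|g^{(i)}(x)-g^{(i)}(y)|\le L_i\|x-y\|$ for $x,y\in X$, with $L_i>0$; * there is a Slater point, i.e. a point $\tilde x\in\operatorname{relint}X$ with $g^{(i)}(\tilde x)<0$ for all $i$. Let $D=\mathbb{R}^m_+$,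 $\mathcal L(x,u)=f(x)+\sum_{i=1}^m u^{(i)}g^{(i)}(x)$, $d(u)=\min_{x\in X}\mathcal L(x,u)$, let $\bar x(u)$ be the minimizer of $\mathcal L(\cdot,u)$ over $X$ (unique for $u\in D$), $d^\star=\sup_{u\in D}d(u)$ and $D^\star=\arg\max_{u\in D}d(u)$. Put $G(u)=\bigcup_{i}\partial g^{(i)}(\bar x(u))$, assume that $\bigcup_{u\in D}G(u)$ is bounded, and let $$\gamma(u)=\frac{\sqrt{m+1}}{\theta}\sup_{q\in G(u)}\|q\|,\qquad \tilde L=\sup_{u\in D}\gamma(u)\Bigl(\sum_{i=1}^m L_i^2\Bigr)^{1/2}.$$ **Algorithm.** Let $h:\mathbb{R}^m\to\mathbb{R}$ be differentiable on an open set containing $D$ and strictly convex on $D$, let $Q(u,v)=h(u)-h(v)-\nabla h(v)^T(u-v)$, and assume $Q(u,v)\ge\frac12\|u-v\|^2$ for all $u,v\in D$. Let $\ell_{-d}(u,v)=-d(v)-\nabla d(v)^T(u-v)$. Let $\beta_0=1$ and $u_0,w_0\in D$, and for each $k\ge0$: * choose a closed convex set $U_k\subseteq\mathbb{R}^m$ with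 $U_k\cap D^\star\ne\emptyset$; * let $v_k=(1-\beta_k)u_k+\beta_kw_k$, let $w_{k+1}\in\arg\min_{u\in U_k\cap D}\,\ell_{-d}(u,v_k)+\beta_k\tilde L\,Q(u,w_k)$, and let $\hat u_{k+1}=(1-\beta_k)u_k+\beta_kw_{k+1}$; * choose $u_{k+1}\in D$ with $\ell_{-d}(u_{k+1},v_k)+\frac{\tilde L}{2}\|u_{k+1}-v_k\|^2\le\ell_{-d}(\hat u_{k+1},v_k)+\frac{\tilde L}{2}\|\hat u_{k+1}-v_k\|^2$; * choose $\beta_{k+1}>0$ with $\beta_{k+1}\le\frac{2}{k+3}$ and $\frac{1-\beta_{k+1}}{\beta_{k+1}^2}\le\frac{1}{\beta_k^2}$ (for instance $\beta_{k+1}=\frac{2}{k+3}$). **Proposition.** Let $(u_k)_{k\ge0}$ be generated by this algorithm, let $\tilde x$ be any Slater point, let $u^\star\in D^\star$ with $u^\star\in U_k$ for all $k$, and let $\bar u\in D\setminus D^\star$. Then for every integer $k>\Bigl(\frac{4\tilde L\,Q(u^\star,w_0)}{d^\star-d(\bar u)}\Bigr)^{1/2}$, $$f(\bar x(u_k))-f^\star\le\frac{\tilde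 L\,\bigl(d(\bar u)-f(\tilde x)\bigr)\bigl(8m\,Q(u^\star,w_0)\bigr)^{1/2}}{(k+1)\max_{1\le i\le m}g^{(i)}(\tilde x)}+\frac{4\tilde L\,Q(u^\star,w_0)}{(k+1)^2}.$$ -/

import Mathlib

open Set Filter Topology

noncomputable section

namespace DualFastGradient

/-- The Euclidean space `ℝⁿ`. -/
abbrev Vec (n : ℕ) := EuclideanSpace ℝ (Fin n)

/-! ### Subdifferential

The subdifferential of a function that is defined on all of `ℝⁿ` but is only known to be convex over
a subset: `q ∈ ∂h(x)` iff `h(y) ≥ h(x) + qᵀ(y - x) - o(‖y - x‖)` as `y → x`.  It is the usual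
subdifferential of convex analysis when `h` is convex (`subdiff_of_convex`), and it is `{∇h(x)}`
whenever `h` is differentiable at `x` (`subdiff_of_differentiableAt`). -/

/-- The subdifferential `∂h(x)`. -/
def subdiff {n : ℕ} (h : Vec n → ℝ) (x : Vec n) : Set (Vec n) :=
  {q | ∀ ε > 0, ∀ᶠ y in 𝓝 x, h x + inner ℝ q (y - x) - ε * ‖y - x‖ ≤ h y}

theorem subdiff_ineq_of_convexOn {n : ℕ} {h : Vec n → ℝ} {X : Set (Vec n)} (hc : ConvexOn ℝ X h)
    {x y q : Vec n} (hx : x ∈ X) (hy : y ∈ X) (hq : q ∈ subdiff h x) :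
    h x + inner ℝ q (y - x) ≤ h y := by
  have key : ∀ ε > 0, h x + inner ℝ q (y - x) - ε * ‖y - x‖ ≤ h y := by
    intro ε hε
    have hcont : Tendsto (fun t : ℝ => x + t • (y - x)) (𝓝[>] 0) (𝓝 x) := by
      have : Continuous (fun t : ℝ => x + t • (y - x)) := by fun_prop
      simpa using (this.tendsto 0).mono_left nhdsWithin_le_nhds
    have h1 := hcont.eventually (hq ε hε)
    have h2 : ∀ᶠ t : ℝ in 𝓝[>] 0, t ∈ Ioo (0 : ℝ) 1 := Ioo_mem_nhdsGT one_pos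
    obtain ⟨t, ht1, ht0, ht2⟩ := (h1.and h2).exists
    have hconv := hc.2 hx hy (by linarith : 0 ≤ 1 - t) ht0.le (by ring)
    have he : (1 - t) • x + t • y = x + t • (y - x) := by
      rw [smul_sub, sub_smul, one_smul]; abel
    rw [he] at hconv
    simp only [add_sub_cancel_left, inner_smul_right, norm_smul, Real.norm_eq_abs, abs_of_pos ht0,
      smul_eq_mul] at ht1 hconv
    have : t * (h x + inner ℝ q (y - x) - ε * ‖y - x‖) ≤ t * h y := by nlinarith
    exact le_of_mul_le_mul_left this ht0
  refine le_of_forall_pos_le_add fun δ hδ => ?_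
  have h1 := key (δ / (‖y - x‖ + 1)) (by positivity)
  have h2 : δ / (‖y - x‖ + 1) * ‖y - x‖ ≤ δ := by
    rw [div_mul_eq_mul_div, div_le_iff₀ (by positivity)]
    nlinarith [norm_nonneg (y - x)]
  linarith

theorem subdiff_of_convex {n : ℕ} {h : Vec n → ℝ} (hc : ConvexOn ℝ univ h) (x : Vec n) :
    subdiff h x = {q | ∀ y, h x + inner ℝ q (y - x) ≤ h y} := by
  ext q
  refine ⟨fun hq y => subdiff_ineq_of_convexOn hc (mem_univ x) (mem_univ y) hq, fun hq ε hε => ?_⟩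
  filter_upwards with y
  have := hq y
  have : 0 ≤ ε * ‖y - x‖ := by positivity
  linarith

theorem subdiff_of_differentiableAt {n : ℕ} {h : Vec n → ℝ} {x : Vec n}
    (hd : DifferentiableAt ℝ h x) : subdiff h x = {gradient h x} := by
  have hg := hasGradientAt_iff_isLittleO.1 hd.hasGradientAt
  ext q
  refine ⟨fun hq => ?_, ?_⟩
  · rw [mem_singleton_iff, ← sub_eq_zero, ← norm_le_zero_iff]
    refine le_of_forall_pos_le_add fun δ hδ => ?_
    rw [zero_add]
    set p := q - gradient h x with hp
    by_contra! hlt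
    have hp0 : 0 < ‖p‖ := hδ.trans hlt
    have hcont : Tendsto (fun t : ℝ => x + t • p) (𝓝[>] 0) (𝓝 x) := by
      have : Continuous (fun t : ℝ => x + t • p) := by fun_prop
      simpa using (this.tendsto 0).mono_left nhdsWithin_le_nhds
    have h1 := hcont.eventually (hq (δ / 2) (by positivity))
    have h2 := hcont.eventually (hg.bound (by positivity : 0 < δ / 2))
    obtain ⟨t, ⟨ht1, ht2⟩, ht0⟩ := ((h1.and h2).and self_mem_nhdsWithin).exists
    have ht0' : (0 : ℝ) < t := ht0
    simp only [add_sub_cancel_left, inner_smul_right, norm_smul, Real.norm_eq_abs,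
      abs_of_pos ht0'] at ht1 ht2
    have h3 := (abs_le.1 ht2).2
    have h4 : inner ℝ q p - inner ℝ (gradient h x) p = ‖p‖ * ‖p‖ := by
      rw [← inner_sub_left, ← hp, real_inner_self_eq_norm_mul_norm]
    have h5 : t * (‖p‖ * ‖p‖) ≤ t * (δ * ‖p‖) := by rw [← h4]; nlinarith
    have h6 := le_of_mul_le_mul_left h5 ht0'
    nlinarith
  · rintro rfl ε hε
    filter_upwards [hg.bound hε] with y hy
    rw [Real.norm_eq_abs] at hy
    have := (abs_le.1 hy).1
    linarith

/-! ### The primal problem: minimize `f x` subject to `g i x ≤ 0` for all `i` and `x ∈ X` -/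

/-- `f` is strongly convex over `X` with convexity parameter `θ`, in terms of subgradients
(which are required to exist at the points of `X`). -/
def StronglyConvexOver {n : ℕ} (X : Set (Vec n)) (θ : ℝ) (f : Vec n → ℝ) : Prop :=
  (∀ x ∈ X, (subdiff f x).Nonempty) ∧
    ∀ x ∈ X, ∀ y ∈ X, ∀ q ∈ subdiff f x, θ / 2 * ‖x - y‖ ^ 2 ≤ f y - f x - inner ℝ q (y - x)

/-- `x` is in the relative interior of `X` and satisfies all the inequalities strictly. -/
def IsSlaterPoint {n m : ℕ} (g : Fin m → Vec n → ℝ) (X : Set (Vec n)) (x : Vec n) : Prop :=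
  x ∈ intrinsicInterior ℝ X ∧ ∀ i, g i x < 0

/-- The standing assumptions on the problem, without equality constraints. -/
structure ProblemAssumptions {n m : ℕ} (f : Vec n → ℝ) (g : Fin m → Vec n → ℝ) (X : Set (Vec n))
    (θ : ℝ) (L : Fin m → ℝ) : Prop where
  closed : IsClosed X
  convex : Convex ℝ X
  theta_pos : 0 < θ
  strong : StronglyConvexOver X θ f
  g_convex : ∀ i, ConvexOn ℝ X (g i)
  g_subgrad : ∀ i, ∀ x ∈ X, (subdiff (g i) x).Nonempty
  L_pos : ∀ i, 0 < L i
  g_lipschitz : ∀ i, ∀ x ∈ X, ∀ y ∈ X, |g i x - g i y| ≤ L i * ‖x - y‖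
  slater : ∃ x, IsSlaterPoint g X x
  constraints : m ≠ 0

/-- The optimal value `f⋆` of the primal problem. -/
def primalValue {n m : ℕ} (f : Vec n → ℝ) (g : Fin m → Vec n → ℝ) (X : Set (Vec n)) : ℝ :=
  sInf (f '' {x | x ∈ X ∧ ∀ i, g i x ≤ 0})

/-! ### The dual problem -/

/-- The Lagrangian. -/
def lagrangian {n m : ℕ} (f : Vec n → ℝ) (g : Fin m → Vec n → ℝ) (x : Vec n) (u : Vec m) : ℝ :=
  f x + ∑ i, u i * g i x

/-- The dual function `d(u) = min_{x ∈ X} ℒ(x, u)`. -/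
def dual {n m : ℕ} (f : Vec n → ℝ) (g : Fin m → Vec n → ℝ) (X : Set (Vec n)) (u : Vec m) : ℝ :=
  sInf ((fun x => lagrangian f g x u) '' X)

/-- The minimizer `x̄(u)` of `ℒ(·, u)` over `X`. -/
def xbar {n m : ℕ} (f : Vec n → ℝ) (g : Fin m → Vec n → ℝ) (X : Set (Vec n)) (u : Vec m) : Vec n :=
  Classical.epsilon fun x => x ∈ X ∧ ∀ y ∈ X, lagrangian f g x u ≤ lagrangian f g y u

/-- The dual feasible set `D`, the nonnegative orthant. -/
def dualSet (m : ℕ) : Set (Vec m) := {u | ∀ i, 0 ≤ u i}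

/-- The dual optimal value `d⋆`. -/
def dualValue {n m : ℕ} (f : Vec n → ℝ) (g : Fin m → Vec n → ℝ) (X : Set (Vec n)) : ℝ :=
  sSup (dual f g X '' dualSet m)

/-- The dual optimal set `D⋆`. -/
def dualOpt {n m : ℕ} (f : Vec n → ℝ) (g : Fin m → Vec n → ℝ) (X : Set (Vec n)) : Set (Vec m) :=
  {u | u ∈ dualSet m ∧ ∀ v ∈ dualSet m, dual f g X v ≤ dual f g X u}

/-- `G(u)`, the union of the subdifferentials of the constraint functions at `x̄(u)`. -/
def G {n m : ℕ} (f : Vec n → ℝ) (g : Fin m → Vec n → ℝ) (X : Set (Vec n)) (u : Vec m) :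
    Set (Vec n) :=
  ⋃ i, subdiff (g i) (xbar f g X u)

/-- `γ(u) = (√(m + 1) / θ) sup_{q ∈ G(u)} ‖q‖`. -/
def gamma {n m : ℕ} (f : Vec n → ℝ) (g : Fin m → Vec n → ℝ) (X : Set (Vec n)) (θ : ℝ)
    (u : Vec m) : ℝ :=
  Real.sqrt (m + 1) / θ * sSup (norm '' G f g X u)

/-- `L̃ = sup_{u ∈ D} γ(u) (∑ i, Lᵢ²)^{1/2}`. -/
def Ltilde {n m : ℕ} (f : Vec n → ℝ) (g : Fin m → Vec n → ℝ) (X : Set (Vec n)) (θ : ℝ)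
    (L : Fin m → ℝ) : ℝ :=
  sSup (gamma f g X θ '' dualSet m) * Real.sqrt (∑ i, L i ^ 2)

/-! ### The fast dual gradient method -/

/-- `Q(u, v) = h(u) - h(v) - ∇h(v)ᵀ(u - v)`. -/
def bregman {m : ℕ} (h : Vec m → ℝ) (u v : Vec m) : ℝ :=
  h u - h v - inner ℝ (gradient h v) (u - v)

/-- Admissible `h`: differentiable on an open set containing `D`, strictly convex on `D`, and
`Q(u, v) ≥ ‖u - v‖² / 2` on `D`. -/
structure IsBregmanKernel {m : ℕ} (h : Vec m → ℝ) : Prop where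
  diff : ∃ O : Set (Vec m), IsOpen O ∧ dualSet m ⊆ O ∧ DifferentiableOn ℝ h O
  strict : StrictConvexOn ℝ (dualSet m) h
  lower : ∀ u ∈ dualSet m, ∀ v ∈ dualSet m, ‖u - v‖ ^ 2 / 2 ≤ bregman h u v

/-- `ℓ_{-d}(u, v) = -d(v) - ∇d(v)ᵀ(u - v)`, the linearization of `-d` at `v`. -/
def linNegDual {n m : ℕ} (f : Vec n → ℝ) (g : Fin m → Vec n → ℝ) (X : Set (Vec n))
    (u v : Vec m) : ℝ :=
  -dual f g X v - inner ℝ (gradient (dual f g X) v) (u - v)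

/-- The sequences are generated by the 1-memory fast gradient method applied to the dual problem,
with constant `Lt`. -/
structure IsFastDualGradient {n m : ℕ} (f : Vec n → ℝ) (g : Fin m → Vec n → ℝ) (X : Set (Vec n))
    (Lt : ℝ) (h : Vec m → ℝ) (β : ℕ → ℝ) (U : ℕ → Set (Vec m)) (u v w uhat : ℕ → Vec m) :
    Prop where
  beta_zero : β 0 = 1
  u_zero : u 0 ∈ dualSet m
  w_zero : w 0 ∈ dualSet m
  U_closed : ∀ k, IsClosed (U k)
  U_convex : ∀ k, Convex ℝ (U k)
  U_inter : ∀ k, (U k ∩ dualOpt f g X).Nonempty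
  v_eq : ∀ k, v k = (1 - β k) • u k + β k • w k
  w_mem : ∀ k, w (k + 1) ∈ U k ∩ dualSet m
  w_min : ∀ k, ∀ z ∈ U k ∩ dualSet m,
    linNegDual f g X (w (k + 1)) (v k) + β k * Lt * bregman h (w (k + 1)) (w k) ≤
      linNegDual f g X z (v k) + β k * Lt * bregman h z (w k)
  uhat_eq : ∀ k, uhat (k + 1) = (1 - β k) • u k + β k • w (k + 1)
  u_mem : ∀ k, u (k + 1) ∈ dualSet m
  u_step : ∀ k,
    linNegDual f g X (u (k + 1)) (v k) + Lt / 2 * ‖u (k + 1) - v k‖ ^ 2 ≤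
      linNegDual f g X (uhat (k + 1)) (v k) + Lt / 2 * ‖uhat (k + 1) - v k‖ ^ 2
  beta_pos : ∀ k, 0 < β (k + 1)
  beta_le : ∀ k : ℕ, β (k + 1) ≤ 2 / ((k : ℝ) + 3)
  beta_step : ∀ k, (1 - β (k + 1)) / β (k + 1) ^ 2 ≤ 1 / β k ^ 2

end DualFastGradient

end

namespace DualFastGradient

/-! For `u ∈ D` the Lagrangian inherits curvature `θ` from `f`, so it grows by at least `θ/2 ‖x -
x̄(u)‖²` away from its minimizer. Together with the Lipschitz bounds on the constraints, this traps
`d` between its linearization at `u` with slope `g(x̄(u))` and that linearization minus a quadratic;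
hence `∇d(u) = g(x̄(u))` (`hasGradientAt_dual`).

Bounding each constraint difference once by subgradients and once by `Lᵢ` sharpens the quadratic
constant to `L̃` (`norm_sq_constraintVec_xbar_sub_le`, `neg_dual_le`). The usual potential argument
for accelerated Bregman methods then gives the dual gap `4 L̃ Q(u⋆, w₀) / (k + 1)²` (`dual_gap_le`).

To return to the primal, weak duality and optimality of `u⋆` bound `f(x̄(u)) - f⋆` by `⟨g(x̄(u⋆)) -
g(x̄(u)), u⟩`. The difference of constraint vectors is of the order of the square root of the dual
gap (`primal_gap_le`). The threshold on `k` gives `d(u_k) ≥ d(ū)`, and the Slater point turns this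
into a bound on the sum of the multipliers (`sum_le_of_dual_le`). The resulting estimate already
holds without the `(k + 1)⁻²` term and with `1` in place of `m`. -/

variable {n m : ℕ}

/-! ### Existence and quadratic growth of minimizers -/

/-- Every point of `X` carries a quadratic minorant of `φ` of curvature `θ`, exact at that point. -/
def HasStrongMinorants (X : Set (Vec n)) (θ : ℝ) (φ : Vec n → ℝ) : Prop :=
  ∀ x ∈ X, ∃ p : Vec n, ∀ y ∈ X, φ x + inner ℝ p (y - x) + θ / 2 * ‖y - x‖ ^ 2 ≤ φ y

theorem HasStrongMinorants.lowerSemicontinuousOn {X : Set (Vec n)} {θ : ℝ} {φ : Vec n → ℝ}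
    (hφ : HasStrongMinorants X θ φ) : LowerSemicontinuousOn φ X := by
  intro x hx a ha
  obtain ⟨p, hp⟩ := hφ x hx
  have hc : Continuous fun y => φ x + inner ℝ p (y - x) + θ / 2 * ‖y - x‖ ^ 2 := by fun_prop
  have h1 : ∀ᶠ y in 𝓝 x, a < φ x + inner ℝ p (y - x) + θ / 2 * ‖y - x‖ ^ 2 :=
    hc.continuousAt.eventually_const_lt (by simpa using ha)
  filter_upwards [nhdsWithin_le_nhds h1, self_mem_nhdsWithin] with y hy hyX
  exact hy.trans_le (hp y hyX)

theorem HasStrongMinorants.exists_min {X : Set (Vec n)} {θ : ℝ} {φ : Vec n → ℝ}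
    (hφ : HasStrongMinorants X θ φ) (hX : IsClosed X) (hne : X.Nonempty) (hθ : 0 < θ) :
    ∃ x ∈ X, ∀ y ∈ X, φ x ≤ φ y := by
  obtain ⟨x₀, hx₀⟩ := hne
  obtain ⟨p, hp⟩ := hφ x₀ hx₀
  -- Beyond this radius the quadratic term of the minorant at `x₀` dominates its linear term, so
  -- values there are at least `φ x₀`.
  set r := 2 * ‖p‖ / θ with hr
  have hr0 : 0 ≤ r := by positivity
  have hK : IsCompact (X ∩ Metric.closedBall x₀ r) :=
    (isCompact_closedBall x₀ r).inter_left hX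
  have hmem : x₀ ∈ X ∩ Metric.closedBall x₀ r := ⟨hx₀, Metric.mem_closedBall_self hr0⟩
  obtain ⟨x, hx, hmin⟩ := (hφ.lowerSemicontinuousOn.mono inter_subset_left).exists_isMinOn
    ⟨x₀, hmem⟩ hK
  refine ⟨x, hx.1, fun y hy => ?_⟩
  by_cases hyr : y ∈ Metric.closedBall x₀ r
  · exact hmin ⟨hy, hyr⟩
  · have h0 : φ x ≤ φ x₀ := hmin hmem
    rw [Metric.mem_closedBall, dist_eq_norm, not_le, hr, div_lt_iff₀ hθ] at hyr
    have h1 := hp y hy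
    have h2 := neg_le_of_abs_le (abs_real_inner_le_norm p (y - x₀))
    have h3 : 0 ≤ ‖y - x₀‖ * (‖y - x₀‖ * θ - 2 * ‖p‖) :=
      mul_nonneg (norm_nonneg _) (by linarith)
    nlinarith

/-- The minorant at `x + t(y - x)` is evaluated at `x` and `y` with weights `1 - t` and `t`: the
linear terms cancel and the quadratic ones leave `t(1 - t)`. Minimality of `x`, division by `t` and
`t → 0` finish. -/
theorem HasStrongMinorants.growth {X : Set (Vec n)} {θ : ℝ} {φ : Vec n → ℝ}
    (hφ : HasStrongMinorants X θ φ) (hX : Convex ℝ X) {x : Vec n} (hx : x ∈ X)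
    (hmin : ∀ y ∈ X, φ x ≤ φ y) {y : Vec n} (hy : y ∈ X) :
    φ x + θ / 2 * ‖y - x‖ ^ 2 ≤ φ y := by
  have key : ∀ t ∈ Ioo (0 : ℝ) 1, φ x + (1 - t) * (θ / 2 * ‖y - x‖ ^ 2) ≤ φ y := by
    rintro t ⟨ht0, ht1⟩
    have hz : x + t • (y - x) ∈ X := hX.add_smul_sub_mem hx hy ⟨ht0.le, ht1.le⟩
    obtain ⟨p, hp⟩ := hφ _ hz
    have h1 := hp x hx
    have h2 := hp y hy
    have h3 := hmin _ hz
    have e1 : x - (x + t • (y - x)) = (-t) • (y - x) := by module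
    have e2 : y - (x + t • (y - x)) = (1 - t) • (y - x) := by module
    rw [e1, inner_smul_right, norm_smul, mul_pow, Real.norm_eq_abs, sq_abs] at h1
    rw [e2, inner_smul_right, norm_smul, mul_pow, Real.norm_eq_abs, sq_abs] at h2
    have h4 := mul_le_mul_of_nonneg_left h1 (by linarith : 0 ≤ 1 - t)
    have h5 := mul_le_mul_of_nonneg_left h2 ht0.le
    have h6 : t * (φ x + (1 - t) * (θ / 2 * ‖y - x‖ ^ 2)) ≤ t * φ y := by linarith
    exact le_of_mul_le_mul_left h6 ht0
  have hc : Continuous fun t : ℝ => φ x + (1 - t) * (θ / 2 * ‖y - x‖ ^ 2) := by fun_prop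
  have ht : Tendsto (fun t : ℝ => φ x + (1 - t) * (θ / 2 * ‖y - x‖ ^ 2)) (𝓝[>] 0)
      (𝓝 (φ x + θ / 2 * ‖y - x‖ ^ 2)) := by
    simpa using (hc.tendsto 0).mono_left nhdsWithin_le_nhds
  refine le_of_tendsto ht ?_
  filter_upwards [Ioo_mem_nhdsGT one_pos] with t ht using key t ht

/-! ### The Lagrangian and its minimizers -/

/-- The vector of constraint values. -/
def constraintVec (g : Fin m → Vec n → ℝ) (x : Vec n) : Vec m := WithLp.toLp 2 fun i => g i x

theorem inner_constraintVec (g : Fin m → Vec n → ℝ) (x : Vec n) (u : Vec m) :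
    inner ℝ (constraintVec g x) u = ∑ i, u i * g i x := by
  simp [constraintVec, PiLp.inner_apply]

theorem lagrangian_eq (f : Vec n → ℝ) (g : Fin m → Vec n → ℝ) (x : Vec n) (u : Vec m) :
    lagrangian f g x u = f x + inner ℝ (constraintVec g x) u := by
  rw [inner_constraintVec, lagrangian]

theorem lagrangian_eq_add (f : Vec n → ℝ) (g : Fin m → Vec n → ℝ) (x : Vec n) (u u' : Vec m) :
    lagrangian f g x u' = lagrangian f g x u + inner ℝ (constraintVec g x) (u' - u) := by
  rw [lagrangian_eq, lagrangian_eq, inner_sub_right]; ring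

section Problem

variable {f : Vec n → ℝ} {g : Fin m → Vec n → ℝ} {X : Set (Vec n)} {θ : ℝ} {L : Fin m → ℝ}

theorem IsSlaterPoint.mem {x : Vec n} (hx : IsSlaterPoint g X x) : x ∈ X :=
  intrinsicInterior_subset hx.1

theorem ProblemAssumptions.nonempty (hp : ProblemAssumptions f g X θ L) : X.Nonempty :=
  let ⟨x, hx⟩ := hp.slater
  ⟨x, hx.mem⟩

theorem ProblemAssumptions.hasStrongMinorants (hp : ProblemAssumptions f g X θ L) {u : Vec m}
    (hu : u ∈ dualSet m) : HasStrongMinorants X θ fun x => lagrangian f g x u := by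
  intro x hx
  obtain ⟨q, hq⟩ := hp.strong.1 x hx
  choose p hpg using fun i => hp.g_subgrad i x hx
  refine ⟨q + ∑ i, u i • p i, fun y hy => ?_⟩
  have h1 := hp.strong.2 x hx y hy q hq
  have h2 : ∑ i, u i * (g i x + inner ℝ (p i) (y - x)) ≤ ∑ i, u i * g i y :=
    Finset.sum_le_sum fun i _ => mul_le_mul_of_nonneg_left
      (subdiff_ineq_of_convexOn (hp.g_convex i) hx hy (hpg i)) (hu i)
  simp only [mul_add, Finset.sum_add_distrib] at h2
  simp only [lagrangian, inner_add_left, sum_inner, real_inner_smul_left]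
  rw [norm_sub_rev] at h1
  linarith

theorem xbar_spec (hp : ProblemAssumptions f g X θ L) {u : Vec m} (hu : u ∈ dualSet m) :
    xbar f g X u ∈ X ∧ ∀ y ∈ X, lagrangian f g (xbar f g X u) u ≤ lagrangian f g y u :=
  Classical.epsilon_spec (p := fun x => x ∈ X ∧ ∀ y ∈ X, lagrangian f g x u ≤ lagrangian f g y u)
    ((hp.hasStrongMinorants hu).exists_min hp.closed hp.nonempty hp.theta_pos)

theorem xbar_mem (hp : ProblemAssumptions f g X θ L) {u : Vec m} (hu : u ∈ dualSet m) :
    xbar f g X u ∈ X :=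
  (xbar_spec hp hu).1

theorem dual_eq (hp : ProblemAssumptions f g X θ L) {u : Vec m} (hu : u ∈ dualSet m) :
    dual f g X u = lagrangian f g (xbar f g X u) u := by
  refine IsLeast.csInf_eq ⟨mem_image_of_mem _ (xbar_mem hp hu), ?_⟩
  rintro _ ⟨y, hy, rfl⟩
  exact (xbar_spec hp hu).2 y hy

theorem dual_le (hp : ProblemAssumptions f g X θ L) {u : Vec m} (hu : u ∈ dualSet m)
    {x : Vec n} (hx : x ∈ X) : dual f g X u ≤ lagrangian f g x u :=
  dual_eq hp hu ▸ (xbar_spec hp hu).2 x hx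

theorem dual_growth (hp : ProblemAssumptions f g X θ L) {u : Vec m} (hu : u ∈ dualSet m)
    {x : Vec n} (hx : x ∈ X) :
    dual f g X u + θ / 2 * ‖x - xbar f g X u‖ ^ 2 ≤ lagrangian f g x u :=
  dual_eq hp hu ▸ (hp.hasStrongMinorants hu).growth hp.convex (xbar_mem hp hu)
    (xbar_spec hp hu).2 hx

theorem norm_constraintVec_sub_le (hp : ProblemAssumptions f g X θ L) {x y : Vec n}
    (hx : x ∈ X) (hy : y ∈ X) :
    ‖constraintVec g x - constraintVec g y‖ ≤ √(∑ i, L i ^ 2) * ‖x - y‖ := by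
  rw [← Real.sqrt_sq (norm_nonneg (x - y)), ← Real.sqrt_mul (by positivity),
    EuclideanSpace.norm_eq]
  refine Real.sqrt_le_sqrt ?_
  rw [Finset.sum_mul]
  refine Finset.sum_le_sum fun i _ => ?_
  rw [← mul_pow]
  exact pow_le_pow_left₀ (norm_nonneg _) (hp.g_lipschitz i x hx y hy) 2

/-- The Lagrangian is affine in the multiplier. Passing from `u` to `u'` changes the slope by at
most a multiple of `‖x - x̄(u)‖`, which the quadratic growth at `u` absorbs. Leaving `u'`
unrestricted is what later gives a full gradient at boundary points of `D`. -/
theorem lagrangian_ge (hp : ProblemAssumptions f g X θ L) {u : Vec m} (hu : u ∈ dualSet m)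
    (u' : Vec m) {x : Vec n} (hx : x ∈ X) :
    dual f g X u + inner ℝ (constraintVec g (xbar f g X u)) (u' - u)
      - (∑ i, L i ^ 2) / (2 * θ) * ‖u' - u‖ ^ 2 ≤ lagrangian f g x u' := by
  have hθ := hp.theta_pos
  have h1 := dual_growth hp hu hx
  have h2 := norm_constraintVec_sub_le hp hx (xbar_mem hp hu)
  have h3 := neg_le_of_abs_le
    (abs_real_inner_le_norm (constraintVec g x - constraintVec g (xbar f g X u)) (u' - u))
  rw [inner_sub_left] at h3
  have h4 := mul_le_mul_of_nonneg_right h2 (norm_nonneg (u' - u))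
  rw [lagrangian_eq_add f g x u u']
  set A := √(∑ i, L i ^ 2) with hA
  have hA2 : ∑ i, L i ^ 2 = A ^ 2 := (Real.sq_sqrt (by positivity)).symm
  set a := ‖u' - u‖
  set r := ‖x - xbar f g X u‖
  -- Completing the square.
  have h5 : A * r * a ≤ θ / 2 * r ^ 2 + A ^ 2 / (2 * θ) * a ^ 2 := by
    have : θ / 2 * r ^ 2 + A ^ 2 / (2 * θ) * a ^ 2 - A * r * a = (θ * r - A * a) ^ 2 / (2 * θ) := by
      field_simp; ring
    have h0 : 0 ≤ (θ * r - A * a) ^ 2 / (2 * θ) := by positivity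
    linarith
  rw [hA2]
  linarith

/-! ### Differentiability of the dual function -/

theorem dual_le_linearization (hp : ProblemAssumptions f g X θ L) {u : Vec m}
    (hu : u ∈ dualSet m) (u' : Vec m) :
    dual f g X u' ≤ dual f g X u + inner ℝ (constraintVec g (xbar f g X u)) (u' - u) := by
  rw [dual_eq hp hu, ← lagrangian_eq_add]
  -- For `u'` outside `D` the infimum must be shown to be finite; `lagrangian_ge` supplies the lower
  -- bound.
  refine csInf_le ⟨dual f g X u + inner ℝ (constraintVec g (xbar f g X u)) (u' - u)
      - (∑ i, L i ^ 2) / (2 * θ) * ‖u' - u‖ ^ 2, ?_⟩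
    (mem_image_of_mem (fun x => lagrangian f g x u') (xbar_mem hp hu))
  rintro _ ⟨x, hx, rfl⟩
  exact lagrangian_ge hp hu u' hx

theorem le_dual (hp : ProblemAssumptions f g X θ L) {u : Vec m} (hu : u ∈ dualSet m)
    (u' : Vec m) :
    dual f g X u + inner ℝ (constraintVec g (xbar f g X u)) (u' - u)
      - (∑ i, L i ^ 2) / (2 * θ) * ‖u' - u‖ ^ 2 ≤ dual f g X u' := by
  refine le_csInf (hp.nonempty.image _) ?_
  rintro _ ⟨x, hx, rfl⟩
  exact lagrangian_ge hp hu u' hx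

theorem hasGradientAt_dual (hp : ProblemAssumptions f g X θ L) {u : Vec m}
    (hu : u ∈ dualSet m) :
    HasGradientAt (dual f g X) (constraintVec g (xbar f g X u)) u := by
  rw [hasGradientAt_iff_isLittleO]
  have hθ := hp.theta_pos
  have h1 : (fun u' => dual f g X u' - dual f g X u
      - inner ℝ (constraintVec g (xbar f g X u)) (u' - u)) =O[𝓝 u] fun u' => ‖u' - u‖ ^ 2 := by
    refine Asymptotics.IsBigO.of_bound ((∑ i, L i ^ 2) / (2 * θ)) (Eventually.of_forall fun u' => ?_)
    have h2 := dual_le_linearization hp hu u'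
    have h3 := le_dual hp hu u'
    rw [Real.norm_eq_abs, Real.norm_eq_abs, abs_of_nonneg (by positivity : 0 ≤ ‖u' - u‖ ^ 2),
      abs_of_nonpos (by linarith)]
    linarith
  refine h1.trans_isLittleO ?_
  have h4 : Tendsto (fun u' : Vec m => u' - u) (𝓝 u) (𝓝 0) := by
    have hc : Continuous fun u' : Vec m => u' - u := by fun_prop
    simpa using hc.tendsto u
  exact (Asymptotics.isLittleO_norm_pow_id one_lt_two).comp_tendsto h4

theorem gradient_dual (hp : ProblemAssumptions f g X θ L) {u : Vec m} (hu : u ∈ dualSet m) :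
    gradient (dual f g X) u = constraintVec g (xbar f g X u) :=
  (hasGradientAt_dual hp hu).gradient

/-- First-order optimality of `us` along the segment to `u`: the quadratic lower bound on `d` is
divided by the step length, which then tends to zero. -/
theorem inner_constraintVec_le_zero_of_dualOpt (hp : ProblemAssumptions f g X θ L)
    {us : Vec m} (hus : us ∈ dualOpt f g X) {u : Vec m} (hu : u ∈ dualSet m) :
    inner ℝ (constraintVec g (xbar f g X us)) (u - us) ≤ 0 := by
  set C := (∑ i, L i ^ 2) / (2 * θ) * ‖u - us‖ ^ 2
  have key : ∀ t ∈ Ioo (0 : ℝ) 1,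
      inner ℝ (constraintVec g (xbar f g X us)) (u - us) ≤ t * C := by
    rintro t ⟨ht0, ht1⟩
    have hmem : us + t • (u - us) ∈ dualSet m := by
      intro i
      have h1 := hus.1 i
      have h2 := hu i
      have h3 : (us + t • (u - us)) i = (1 - t) * us i + t * u i := by
        simp; ring
      rw [h3]
      have : 0 ≤ 1 - t := by linarith
      positivity
    have h1 := le_dual hp hus.1 (us + t • (u - us))
    have h2 := hus.2 _ hmem
    rw [add_sub_cancel_left, inner_smul_right, norm_smul, mul_pow, Real.norm_eq_abs, sq_abs] at h1
    have h3 : t * inner ℝ (constraintVec g (xbar f g X us)) (u - us) ≤ t * (t * C) := by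
      simp only [C]; nlinarith
    exact le_of_mul_le_mul_left h3 ht0
  have ht : Tendsto (fun t : ℝ => t * C) (𝓝[>] 0) (𝓝 0) := by
    have hc : Continuous fun t : ℝ => t * C := by fun_prop
    simpa using (hc.tendsto 0).mono_left nhdsWithin_le_nhds
  refine ge_of_tendsto ht ?_
  filter_upwards [Ioo_mem_nhdsGT one_pos] with t ht using key t ht

/-! ### The constant `L̃` and the descent inequality -/

theorem exists_subgradient_bound (hp : ProblemAssumptions f g X θ L)
    (hbdd : Bornology.IsBounded (⋃ u ∈ dualSet m, G f g X u)) :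
    ∃ S : ℝ, (∀ u ∈ dualSet m, ∀ q ∈ G f g X u, ‖q‖ ≤ S) ∧
      √(m + 1) * S * √(∑ i, L i ^ 2) = θ * Ltilde f g X θ L := by
  have hθ := hp.theta_pos
  have hm : 0 < √((m : ℝ) + 1) := by positivity
  obtain ⟨R, hR⟩ := hbdd.exists_norm_le
  have hR' : ∀ u ∈ dualSet m, ∀ q ∈ G f g X u, ‖q‖ ≤ R := fun u hu q hq =>
    hR q (mem_biUnion hu hq)
  have hbG : ∀ u ∈ dualSet m, BddAbove (norm '' G f g X u) := fun u hu =>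
    ⟨R, by rintro _ ⟨q, hq, rfl⟩; exact hR' u hu q hq⟩
  have hbγ : BddAbove (gamma f g X θ '' dualSet m) := by
    refine ⟨√(m + 1) / θ * max R 0, ?_⟩
    rintro _ ⟨u, hu, rfl⟩
    refine mul_le_mul_of_nonneg_left (Real.sSup_le ?_ (le_max_right _ _)) (by positivity)
    rintro _ ⟨q, hq, rfl⟩
    exact (hR' u hu q hq).trans (le_max_left _ _)
  -- `S` is `sup γ` with its normalization undone. Boundedness of the subgradients makes the real
  -- suprema genuine rather than the default `0`.
  refine ⟨θ / √(m + 1) * sSup (gamma f g X θ '' dualSet m), fun u hu q hq => ?_, ?_⟩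
  · have h1 : ‖q‖ ≤ sSup (norm '' G f g X u) := le_csSup (hbG u hu) (mem_image_of_mem _ hq)
    have h2 : gamma f g X θ u ≤ sSup (gamma f g X θ '' dualSet m) :=
      le_csSup hbγ (mem_image_of_mem _ hu)
    have h3 : ‖q‖ = θ / √(m + 1) * (√(m + 1) / θ * ‖q‖) := by field_simp
    rw [h3]
    refine mul_le_mul_of_nonneg_left (le_trans ?_ h2) (by positivity)
    exact mul_le_mul_of_nonneg_left h1 (by positivity)
  · rw [Ltilde]
    field_simp

theorem sub_le_of_subgradient_norm_le (hp : ProblemAssumptions f g X θ L) {S : ℝ} {u : Vec m}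
    (hu : u ∈ dualSet m) (hS : ∀ q ∈ G f g X u, ‖q‖ ≤ S) (i : Fin m) {y : Vec n} (hy : y ∈ X) :
    g i (xbar f g X u) - g i y ≤ S * ‖xbar f g X u - y‖ := by
  obtain ⟨q, hq⟩ := hp.g_subgrad i _ (xbar_mem hp hu)
  have h1 := subdiff_ineq_of_convexOn (hp.g_convex i) (xbar_mem hp hu) hy hq
  have h2 := neg_le_of_abs_le (abs_real_inner_le_norm q (y - xbar f g X u))
  have h3 := mul_le_mul_of_nonneg_right (hS q (mem_iUnion.2 ⟨i, hq⟩))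
    (norm_nonneg (y - xbar f g X u))
  rw [norm_sub_rev]
  linarith

/-- Each squared difference is a product of two copies of itself, one bounded by `S r` and the other
by `Lᵢ r`. Cauchy–Schwarz on `∑ Lᵢ` then yields `L̃`. -/
theorem norm_sq_constraintVec_xbar_sub_le (hp : ProblemAssumptions f g X θ L)
    (hbdd : Bornology.IsBounded (⋃ u ∈ dualSet m, G f g X u)) {u v : Vec m}
    (hu : u ∈ dualSet m) (hv : v ∈ dualSet m) :
    ‖constraintVec g (xbar f g X u) - constraintVec g (xbar f g X v)‖ ^ 2 ≤
      θ * Ltilde f g X θ L * ‖xbar f g X u - xbar f g X v‖ ^ 2 := by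
  obtain ⟨S, hS, hSL⟩ := exists_subgradient_bound hp hbdd
  have hS0 : 0 ≤ S := by
    obtain ⟨q, hq⟩ := hp.g_subgrad ⟨0, Nat.pos_of_ne_zero hp.constraints⟩ _ (xbar_mem hp hu)
    exact (norm_nonneg q).trans (hS u hu q (mem_iUnion.2 ⟨_, hq⟩))
  set r := ‖xbar f g X u - xbar f g X v‖ with hr
  have h1 : ∀ i, (g i (xbar f g X u) - g i (xbar f g X v)) ^ 2 ≤ S * L i * r ^ 2 := by
    intro i
    have ha := hp.g_lipschitz i _ (xbar_mem hp hu) _ (xbar_mem hp hv)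
    have hb : |g i (xbar f g X u) - g i (xbar f g X v)| ≤ S * r := by
      refine abs_sub_le_iff.2 ⟨sub_le_of_subgradient_norm_le hp hu (hS u hu) i (xbar_mem hp hv), ?_⟩
      rw [hr, norm_sub_rev]
      exact sub_le_of_subgradient_norm_le hp hv (hS v hv) i (xbar_mem hp hu)
    have hc := mul_le_mul hb ha (abs_nonneg _) (by positivity)
    rw [← sq_abs, sq]
    linarith
  have h2 : ∑ i, L i ≤ √(m + 1) * √(∑ i, L i ^ 2) := by
    rw [← Real.sqrt_mul (by positivity)]
    refine Real.le_sqrt_of_sq_le ((sq_sum_le_card_mul_sum_sq (s := Finset.univ)).trans ?_)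
    rw [Finset.card_univ, Fintype.card_fin]
    have : 0 ≤ ∑ i, L i ^ 2 := by positivity
    linarith
  calc ‖constraintVec g (xbar f g X u) - constraintVec g (xbar f g X v)‖ ^ 2
      = ∑ i, (g i (xbar f g X u) - g i (xbar f g X v)) ^ 2 := by
        simp [EuclideanSpace.norm_sq_eq, constraintVec]
    _ ≤ ∑ i, S * L i * r ^ 2 := Finset.sum_le_sum fun i _ => h1 i
    _ = S * (∑ i, L i) * r ^ 2 := by rw [Finset.mul_sum, Finset.sum_mul]
    _ ≤ S * (√(m + 1) * √(∑ i, L i ^ 2)) * r ^ 2 := by gcongr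
    _ = θ * Ltilde f g X θ L * r ^ 2 := by rw [← hSL]; ring

theorem Ltilde_nonneg (hp : ProblemAssumptions f g X θ L) : 0 ≤ Ltilde f g X θ L := by
  have hθ := hp.theta_pos
  refine mul_nonneg (Real.sSup_nonneg ?_) (Real.sqrt_nonneg _)
  rintro _ ⟨u, -, rfl⟩
  refine mul_nonneg (by positivity) (Real.sSup_nonneg ?_)
  rintro _ ⟨q, -, rfl⟩
  exact norm_nonneg q

/-- The descent inequality: `∇d` behaves on `D` as an `L̃`-Lipschitz gradient. -/
theorem neg_dual_le (hp : ProblemAssumptions f g X θ L)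
    (hbdd : Bornology.IsBounded (⋃ u ∈ dualSet m, G f g X u)) {u v : Vec m}
    (hu : u ∈ dualSet m) (hv : v ∈ dualSet m) :
    -dual f g X u ≤ linNegDual f g X u v + Ltilde f g X θ L / 2 * ‖u - v‖ ^ 2 := by
  have hθ := hp.theta_pos
  have hL := Ltilde_nonneg hp
  have h1 := dual_growth hp hv (xbar_mem hp hu)
  have h2 := lagrangian_eq_add f g (xbar f g X u) v u
  rw [← dual_eq hp hu] at h2
  have h3 := norm_sq_constraintVec_xbar_sub_le hp hbdd hu hv
  have h4 := neg_le_of_abs_le (abs_real_inner_le_norm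
    (constraintVec g (xbar f g X u) - constraintVec g (xbar f g X v)) (u - v))
  rw [inner_sub_left] at h4
  rw [linNegDual, gradient_dual hp hv]
  set N := ‖constraintVec g (xbar f g X u) - constraintVec g (xbar f g X v)‖
  set r := ‖xbar f g X u - xbar f g X v‖
  set a := ‖u - v‖
  set K := Ltilde f g X θ L
  have h5 : N * a ≤ θ / 2 * r ^ 2 + K / 2 * a ^ 2 := by
    -- AM–GM after squaring, which avoids dividing by a possibly zero `K`.
    refine le_of_abs_le (abs_le_of_sq_le_sq ?_ (by positivity))
    have h6 := mul_le_mul_of_nonneg_right h3 (sq_nonneg a)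
    nlinarith [sq_nonneg (θ / 2 * r ^ 2 - K / 2 * a ^ 2)]
  linarith

theorem linNegDual_le (hp : ProblemAssumptions f g X θ L) {v : Vec m} (hv : v ∈ dualSet m)
    (u : Vec m) : linNegDual f g X u v ≤ -dual f g X u := by
  have := dual_le_linearization hp hv u
  rw [linNegDual, gradient_dual hp hv]
  linarith

theorem linNegDual_combo (f : Vec n → ℝ) (g : Fin m → Vec n → ℝ) (X : Set (Vec n))
    (u w v : Vec m) (b : ℝ) :
    linNegDual f g X ((1 - b) • u + b • w) v =
      (1 - b) * linNegDual f g X u v + b * linNegDual f g X w v := by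
  simp only [linNegDual, inner_sub_right, inner_add_right, inner_smul_right]
  ring

/-! ### Bregman proximal steps -/

theorem convex_dualSet (m : ℕ) : Convex ℝ (dualSet m) := by
  intro u hu v hv a b ha hb _ i
  have h1 := hu i
  have h2 := hv i
  simp only [PiLp.add_apply, PiLp.smul_apply, smul_eq_mul]
  positivity

theorem IsBregmanKernel.hasGradientAt {h : Vec m → ℝ} (hh : IsBregmanKernel h) {u : Vec m}
    (hu : u ∈ dualSet m) : HasGradientAt h (gradient h u) u := by
  obtain ⟨O, hO, hDO, hd⟩ := hh.diff
  exact (hd.differentiableAt (hO.mem_nhds (hDO hu))).hasGradientAt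

theorem IsBregmanKernel.bregman_nonneg {h : Vec m → ℝ} (hh : IsBregmanKernel h) {u v : Vec m}
    (hu : u ∈ dualSet m) (hv : v ∈ dualSet m) : 0 ≤ bregman h u v :=
  le_trans (by positivity) (hh.lower u hu v hv)

/-- The three-point inequality for a Bregman proximal step with a linear objective. -/
theorem IsBregmanKernel.three_point {h : Vec m → ℝ} (hh : IsBregmanKernel h) {C : Set (Vec m)}
    (hC : Convex ℝ C) {a w w' z : Vec m} {b c : ℝ} (hw' : w' ∈ C) (hw'D : w' ∈ dualSet m)
    (hz : z ∈ C)
    (hmin : ∀ y ∈ C, b + inner ℝ a w' + c * bregman h w' w ≤ b + inner ℝ a y + c * bregman h y w) :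
    b + inner ℝ a w' + c * bregman h w' w + c * bregman h z w' ≤
      b + inner ℝ a z + c * bregman h z w := by
  have hd : HasFDerivAt (fun y => b + inner ℝ a y + c * bregman h y w)
      (innerSL ℝ a + c • (innerSL ℝ (gradient h w') - innerSL ℝ (gradient h w))) w' := by
    have h1 : HasFDerivAt h (innerSL ℝ (gradient h w')) w' := (hh.hasGradientAt hw'D).hasFDerivAt
    have h2 : HasFDerivAt (fun y => inner ℝ (gradient h w) (y - w)) (innerSL ℝ (gradient h w)) w' :=
      (innerSL ℝ (gradient h w)).hasFDerivAt.comp w' ((hasFDerivAt_id w').sub_const w)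
    have h3 : HasFDerivAt (fun y => inner ℝ a y) (innerSL ℝ a) w' := (innerSL ℝ a).hasFDerivAt
    exact (h3.const_add b).add (((h1.sub_const (h w)).sub h2).const_mul c)
  have hloc : IsLocalMinOn (fun y => b + inner ℝ a y + c * bregman h y w) C w' :=
    (show IsMinOn (fun y => b + inner ℝ a y + c * bregman h y w) C w' from hmin).localize
  -- The first-order condition in direction `z - w'` suffices: the three Bregman terms differ
  -- exactly by `⟨∇h(w') - ∇h(w), z - w'⟩`.
  have h4 := hloc.hasFDerivWithinAt_nonneg hd.hasFDerivWithinAt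
    (sub_mem_posTangentConeAt_of_segment_subset (hC.segment_subset hw' hz))
  simp only [_root_.add_apply, _root_.smul_apply,
    _root_.sub_apply, innerSL_apply_apply, smul_eq_mul, inner_sub_right] at h4
  simp only [bregman, inner_sub_right]
  linarith

/-! ### Convergence of the accelerated method -/

section Algorithm

variable {h : Vec m → ℝ} {β : ℕ → ℝ} {U : ℕ → Set (Vec m)} {u v w uhat : ℕ → Vec m} {Lt : ℝ}

theorem IsFastDualGradient.beta_pos' (ha : IsFastDualGradient f g X Lt h β U u v w uhat) (k : ℕ) :
    0 < β k := by
  cases k with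
  | zero => rw [ha.beta_zero]; exact one_pos
  | succ k => exact ha.beta_pos k

theorem IsFastDualGradient.beta_le' (ha : IsFastDualGradient f g X Lt h β U u v w uhat) (k : ℕ) :
    β k ≤ 2 / ((k : ℝ) + 2) := by
  cases k with
  | zero => rw [ha.beta_zero]; norm_num
  | succ k =>
    have := ha.beta_le k
    push_cast
    rwa [show (k : ℝ) + 1 + 2 = k + 3 by ring]

theorem IsFastDualGradient.beta_le_one (ha : IsFastDualGradient f g X Lt h β U u v w uhat)
    (k : ℕ) : β k ≤ 1 := by
  refine (ha.beta_le' k).trans ((div_le_one (by positivity)).2 ?_)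
  have : (0 : ℝ) ≤ k := k.cast_nonneg
  linarith

theorem IsFastDualGradient.u_mem' (ha : IsFastDualGradient f g X Lt h β U u v w uhat) (k : ℕ) :
    u k ∈ dualSet m := by
  cases k with
  | zero => exact ha.u_zero
  | succ k => exact ha.u_mem k

theorem IsFastDualGradient.w_mem' (ha : IsFastDualGradient f g X Lt h β U u v w uhat) (k : ℕ) :
    w k ∈ dualSet m := by
  cases k with
  | zero => exact ha.w_zero
  | succ k => exact (ha.w_mem k).2

theorem IsFastDualGradient.v_mem (ha : IsFastDualGradient f g X Lt h β U u v w uhat) (k : ℕ) :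
    v k ∈ dualSet m := by
  rw [ha.v_eq]
  exact convex_dualSet m (ha.u_mem' k) (ha.w_mem' k) (by linarith [ha.beta_le_one k])
    (ha.beta_pos' k).le (by ring)

/-- Since `û_{k+1} - v_k = β_k (w_{k+1} - w_k)`, the quadratic term of the descent inequality is at
most `β_k² L̃ Q(w_{k+1}, w_k)`. The three-point inequality, scaled by `β_k`, cancels this and leaves
a telescoping difference. -/
theorem IsFastDualGradient.step (hp : ProblemAssumptions f g X θ L)
    (hbdd : Bornology.IsBounded (⋃ u ∈ dualSet m, G f g X u)) (hh : IsBregmanKernel h)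
    (ha : IsFastDualGradient f g X (Ltilde f g X θ L) h β U u v w uhat) {z : Vec m}
    (hz : z ∈ dualSet m) (hzU : ∀ k, z ∈ U k) (k : ℕ) :
    dual f g X z - dual f g X (u (k + 1)) ≤
      (1 - β k) * (dual f g X z - dual f g X (u k)) +
        β k ^ 2 * (Ltilde f g X θ L * (bregman h z (w k) - bregman h z (w (k + 1)))) := by
  have hL := Ltilde_nonneg hp
  have hb := ha.beta_pos' k
  have hb1 := ha.beta_le_one k
  set K := Ltilde f g X θ L
  have h1 := neg_dual_le hp hbdd (ha.u_mem k) (ha.v_mem k)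
  have h2 := ha.u_step k
  have e1 : uhat (k + 1) - v k = β k • (w (k + 1) - w k) := by
    rw [ha.uhat_eq, ha.v_eq]; module
  rw [e1, norm_smul, mul_pow, Real.norm_eq_abs, sq_abs, ha.uhat_eq, linNegDual_combo] at h2
  have h3 := linNegDual_le hp (ha.v_mem k) (u k)
  have h4 := linNegDual_le hp (ha.v_mem k) z
  have h5 := hh.lower _ (ha.w_mem k).2 _ (ha.w_mem' k)
  have hlin : ∀ y, linNegDual f g X y (v k) =
      (-dual f g X (v k) + inner ℝ (gradient (dual f g X) (v k)) (v k)) +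
        inner ℝ (-gradient (dual f g X) (v k)) y := by
    intro y
    rw [linNegDual, inner_sub_right, inner_neg_left]; ring
  have hmin := ha.w_min k
  simp only [hlin] at hmin
  have h6 := hh.three_point ((ha.U_convex k).inter (convex_dualSet m)) (ha.w_mem k)
    (ha.w_mem k).2 ⟨hzU k, hz⟩ hmin
  simp only [← hlin] at h6
  have h7 := mul_le_mul_of_nonneg_left h3 (by linarith : 0 ≤ 1 - β k)
  have h8 := mul_le_mul_of_nonneg_left (h6.trans (add_le_add_left h4 _)) hb.le
  have h9 := mul_le_mul_of_nonneg_left h5 (by positivity : 0 ≤ β k ^ 2 * K)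
  linarith

theorem IsFastDualGradient.potential_le (hp : ProblemAssumptions f g X θ L)
    (hbdd : Bornology.IsBounded (⋃ u ∈ dualSet m, G f g X u)) (hh : IsBregmanKernel h)
    (ha : IsFastDualGradient f g X (Ltilde f g X θ L) h β U u v w uhat) {z : Vec m}
    (hz : z ∈ dualOpt f g X) (hzU : ∀ k, z ∈ U k) (k : ℕ) :
    (dual f g X z - dual f g X (u (k + 1))) / β k ^ 2 + Ltilde f g X θ L * bregman h z (w (k + 1))
      ≤ Ltilde f g X θ L * bregman h z (w 0) := by
  induction k with
  | zero =>
    have := ha.step hp hbdd hh hz.1 hzU 0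
    -- `β₀ = 1` removes the initial dual gap.
    rw [ha.beta_zero] at this ⊢
    simp only [zero_add] at this ⊢
    linarith
  | succ k ih =>
    refine le_trans ?_ ih
    have hb := ha.beta_pos (k := k)
    have hb0 := ha.beta_pos' k
    have h1 := ha.step hp hbdd hh hz.1 hzU (k + 1)
    have h2 : 0 ≤ dual f g X z - dual f g X (u (k + 1)) := sub_nonneg.2 (hz.2 _ (ha.u_mem k))
    -- The condition on `β` makes the potential nonincreasing; optimality of `z` is needed for the
    -- sign of the gap.
    have h3 := mul_le_mul_of_nonneg_right (ha.beta_step k) h2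
    have h4 := div_le_div_of_nonneg_right h1 (sq_nonneg (β (k + 1)))
    rw [add_div, mul_div_cancel_left₀ _ (by positivity)] at h4
    rw [div_mul_eq_mul_div] at h3
    have h5 : 1 / β k ^ 2 * (dual f g X z - dual f g X (u (k + 1))) =
        (dual f g X z - dual f g X (u (k + 1))) / β k ^ 2 := by ring
    linarith

theorem IsFastDualGradient.dual_gap_le (hp : ProblemAssumptions f g X θ L)
    (hbdd : Bornology.IsBounded (⋃ u ∈ dualSet m, G f g X u)) (hh : IsBregmanKernel h)
    (ha : IsFastDualGradient f g X (Ltilde f g X θ L) h β U u v w uhat) {z : Vec m}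
    (hz : z ∈ dualOpt f g X) (hzU : ∀ k, z ∈ U k) {k : ℕ} (hk : k ≠ 0) :
    dual f g X z - dual f g X (u k) ≤
      4 * Ltilde f g X θ L * bregman h z (w 0) / ((k : ℝ) + 1) ^ 2 := by
  obtain ⟨k, rfl⟩ := Nat.exists_eq_succ_of_ne_zero hk
  have hL := Ltilde_nonneg hp
  have hb := ha.beta_pos' k
  have hQ := hh.bregman_nonneg hz.1 ha.w_zero
  have h1 := ha.potential_le hp hbdd hh hz hzU k
  have h2 := mul_nonneg hL (hh.bregman_nonneg hz.1 (ha.w_mem k).2)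
  have h3 : (dual f g X z - dual f g X (u (k + 1))) / β k ^ 2 ≤
      Ltilde f g X θ L * bregman h z (w 0) := by linarith
  rw [div_le_iff₀ (by positivity)] at h3
  -- The gap at index `k + 1` is governed by `β k`, so `2 / (k + 2)` becomes `2 / (index + 1)`.
  have h4 : β k ^ 2 ≤ (2 / ((k : ℝ) + 2)) ^ 2 := pow_le_pow_left₀ hb.le (ha.beta_le' k) 2
  refine h3.trans ((mul_le_mul_of_nonneg_left h4 (mul_nonneg hL hQ)).trans (le_of_eq ?_))
  push_cast
  rw [show (k : ℝ) + 1 + 1 = k + 2 by ring, div_pow]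
  ring

end Algorithm

/-! ### From the dual gap to the primal gap -/

theorem dualValue_eq {z : Vec m} (hz : z ∈ dualOpt f g X) :
    dualValue f g X = dual f g X z := by
  refine IsGreatest.csSup_eq ⟨mem_image_of_mem _ hz.1, ?_⟩
  rintro _ ⟨y, hy, rfl⟩
  exact hz.2 y hy

theorem dual_le_primalValue (hp : ProblemAssumptions f g X θ L) {u : Vec m}
    (hu : u ∈ dualSet m) : dual f g X u ≤ primalValue f g X := by
  obtain ⟨x, hx⟩ := hp.slater
  refine le_csInf ⟨f x, mem_image_of_mem _ ⟨hx.mem, fun i => (hx.2 i).le⟩⟩ ?_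
  rintro _ ⟨y, ⟨hyX, hyg⟩, rfl⟩
  have h1 := dual_le hp hu hyX
  have h2 : ∑ i, u i * g i y ≤ 0 :=
    Finset.sum_nonpos fun i _ => mul_nonpos_of_nonneg_of_nonpos (hu i) (hyg i)
  rw [lagrangian] at h1
  linarith

theorem iSup_slater_neg (hp : ProblemAssumptions f g X θ L) {x : Vec n}
    (hx : IsSlaterPoint g X x) : ⨆ i, g i x < 0 := by
  have : Nonempty (Fin m) := ⟨⟨0, Nat.pos_of_ne_zero hp.constraints⟩⟩
  obtain ⟨i, hi⟩ := exists_eq_ciSup_of_finite (f := fun i => g i x)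
  rw [← hi]
  exact hx.2 i

theorem sum_le_of_dual_le (hp : ProblemAssumptions f g X θ L) {x : Vec n}
    (hx : IsSlaterPoint g X x) {u : Vec m} (hu : u ∈ dualSet m) {c : ℝ}
    (hc : c ≤ dual f g X u) : ∑ i, u i ≤ (c - f x) / ⨆ i, g i x := by
  have h0 := iSup_slater_neg hp hx
  rw [le_div_iff_of_neg h0, Finset.sum_mul]
  have h1 := dual_le hp hu hx.mem
  have h2 : ∑ i, u i * g i x ≤ ∑ i, u i * ⨆ i, g i x :=
    Finset.sum_le_sum fun i _ => mul_le_mul_of_nonneg_left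
      (le_ciSup (f := fun i => g i x) (finite_range _).bddAbove i) (hu i)
  rw [lagrangian] at h1
  linarith

/-- A small dual gap `e` at `u` forces a primal suboptimality of order `√e` at `x̄(u)`. -/
theorem primal_gap_le (hp : ProblemAssumptions f g X θ L)
    (hbdd : Bornology.IsBounded (⋃ u ∈ dualSet m, G f g X u)) {us u : Vec m}
    (hus : us ∈ dualOpt f g X) (hu : u ∈ dualSet m) :
    f (xbar f g X u) - primalValue f g X ≤
      (∑ i, u i) * √(2 * Ltilde f g X θ L * (dual f g X us - dual f g X u)) := by
  have hθ := hp.theta_pos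
  have hL := Ltilde_nonneg hp
  have h1 := dual_le_primalValue hp hus.1
  have h2 := dual_growth hp hu (xbar_mem hp hus.1)
  have h3 := lagrangian_eq_add f g (xbar f g X us) us u
  rw [← dual_eq hp hus.1] at h3
  have h4 := inner_constraintVec_le_zero_of_dualOpt hp hus hu
  -- Taking `u = 0` gives `⟨g(x̄(u⋆)), u⋆⟩ ≥ 0`, the only half of complementary slackness required.
  have h5 := inner_constraintVec_le_zero_of_dualOpt hp hus (u := 0) fun i => le_rfl
  have h6 := dual_eq hp hu
  rw [lagrangian_eq] at h6
  have h7 := norm_sq_constraintVec_xbar_sub_le hp hbdd hus.1 hu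
  have h8 : ‖constraintVec g (xbar f g X us) - constraintVec g (xbar f g X u)‖ ≤
      √(2 * Ltilde f g X θ L * (dual f g X us - dual f g X u)) := by
    refine Real.le_sqrt_of_sq_le (h7.trans ?_)
    have : θ / 2 * ‖xbar f g X us - xbar f g X u‖ ^ 2 ≤ dual f g X us - dual f g X u := by linarith
    nlinarith [mul_le_mul_of_nonneg_left this hL]
  have h9 : inner ℝ (constraintVec g (xbar f g X us) - constraintVec g (xbar f g X u)) u ≤
      (∑ i, u i) * √(2 * Ltilde f g X θ L * (dual f g X us - dual f g X u)) := by
    rw [PiLp.inner_apply, Finset.sum_mul]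
    refine Finset.sum_le_sum fun i _ => ?_
    have ha := (le_abs_self _).trans ((PiLp.norm_apply_le
      (constraintVec g (xbar f g X us) - constraintVec g (xbar f g X u)) i).trans h8)
    simpa using mul_le_mul_of_nonneg_left ha (hu i)
  have h10 : 0 ≤ θ / 2 * ‖xbar f g X us - xbar f g X u‖ ^ 2 := by positivity
  rw [inner_sub_left] at h9
  rw [inner_sub_right] at h3 h5
  rw [inner_zero_right] at h5
  linarith

end Problem

end DualFastGradient

theorem mainTheorem9 {n m : ℕ}
    (f : DualFastGradient.Vec n → ℝ) (g : Fin m → DualFastGradient.Vec n → ℝ)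
    (X : Set (DualFastGradient.Vec n)) (θ : ℝ) (L : Fin m → ℝ)
    (hprob : DualFastGradient.ProblemAssumptions f g X θ L)
    (hbdd : Bornology.IsBounded
      (⋃ u ∈ DualFastGradient.dualSet m, DualFastGradient.G f g X u))
    (h : DualFastGradient.Vec m → ℝ) (hh : DualFastGradient.IsBregmanKernel h)
    (β : ℕ → ℝ) (U : ℕ → Set (DualFastGradient.Vec m))
    (u v w uhat : ℕ → DualFastGradient.Vec m)
    (halg : DualFastGradient.IsFastDualGradient f g X
      (DualFastGradient.Ltilde f g X θ L) h β U u v w uhat)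
    (xtilde : DualFastGradient.Vec n) (hxtilde : DualFastGradient.IsSlaterPoint g X xtilde)
    (ustar : DualFastGradient.Vec m) (hustar : ustar ∈ DualFastGradient.dualOpt f g X)
    (hustarU : ∀ k, ustar ∈ U k)
    (ubar : DualFastGradient.Vec m)
    (hubar : ubar ∈ DualFastGradient.dualSet m \ DualFastGradient.dualOpt f g X)
    (k : ℕ)
    (hk : Real.sqrt (4 * DualFastGradient.Ltilde f g X θ L *
        DualFastGradient.bregman h ustar (w 0) /
        (DualFastGradient.dualValue f g X - DualFastGradient.dual f g X ubar)) < (k : ℝ)) :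
    f (DualFastGradient.xbar f g X (u k)) - DualFastGradient.primalValue f g X ≤
      DualFastGradient.Ltilde f g X θ L * (DualFastGradient.dual f g X ubar - f xtilde) *
          Real.sqrt (8 * (m : ℝ) * DualFastGradient.bregman h ustar (w 0)) /
          (((k : ℝ) + 1) * (⨆ i, g i xtilde)) +
        4 * DualFastGradient.Ltilde f g X θ L * DualFastGradient.bregman h ustar (w 0) /
          ((k : ℝ) + 1) ^ 2 := by
  have hk0 : k ≠ 0 := by
    rintro rfl
    exact absurd hk (not_lt.2 (by simp))
  have hgap := halg.dual_gap_le hprob hbdd hh hustar hustarU hk0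
  have hL := DualFastGradient.Ltilde_nonneg hprob
  have hQ := hh.bregman_nonneg hustar.1 halg.w_zero
  rw [DualFastGradient.dualValue_eq hustar] at hk
  have hprimal := DualFastGradient.primal_gap_le hprob hbdd hustar (halg.u_mem' k)
  have hneg := DualFastGradient.iSup_slater_neg hprob hxtilde
  have hbar : 0 < DualFastGradient.dual f g X ustar - DualFastGradient.dual f g X ubar := by
    by_contra hcon
    exact hubar.2 ⟨hubar.1, fun y hy => (hustar.2 y hy).trans (by linarith)⟩
  set K := DualFastGradient.Ltilde f g X θ L
  set q := DualFastGradient.bregman h ustar (w 0)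
  set s := ⨆ i, g i xtilde
  -- Here the threshold on `k` enters: together with `hgap` it yields `d(u_k) ≥ d(ū)`.
  have hgap2 : 4 * K * q / ((k : ℝ) + 1) ^ 2 ≤
      DualFastGradient.dual f g X ustar - DualFastGradient.dual f g X ubar := by
    have h1 := (Real.sqrt_lt' (by positivity : (0 : ℝ) < k)).1 hk
    rw [div_lt_iff₀ hbar] at h1
    rw [div_le_iff₀ (by positivity)]
    have hk' : (0 : ℝ) ≤ k := k.cast_nonneg
    nlinarith
  have hsum := DualFastGradient.sum_le_of_dual_le hprob hxtilde (halg.u_mem' k)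
    (c := DualFastGradient.dual f g X ubar) (by linarith)
  have hsum0 : 0 ≤ ∑ i, u k i := Finset.sum_nonneg fun i _ => halg.u_mem' k i
  have hm : (1 : ℝ) ≤ m := by exact_mod_cast Nat.one_le_iff_ne_zero.2 hprob.constraints
  have hsqrt : √(2 * K * (DualFastGradient.dual f g X ustar - DualFastGradient.dual f g X (u k))) ≤
      K * √(8 * m * q) / (k + 1) := by
    refine Real.sqrt_le_iff.2 ⟨by positivity, ?_⟩
    rw [div_pow, mul_pow, Real.sq_sqrt (by positivity)]
    calc 2 * K * (DualFastGradient.dual f g X ustar - DualFastGradient.dual f g X (u k))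
        ≤ 2 * K * (4 * K * q / ((k : ℝ) + 1) ^ 2) := by gcongr
      _ = K ^ 2 * (8 * 1 * q) / ((k : ℝ) + 1) ^ 2 := by ring
      _ ≤ K ^ 2 * (8 * m * q) / ((k : ℝ) + 1) ^ 2 := by gcongr
  have hfinal := mul_le_mul hsum hsqrt (Real.sqrt_nonneg _) (hsum0.trans hsum)
  have hrest : 0 ≤ 4 * K * q / ((k : ℝ) + 1) ^ 2 := by positivity
  have he : (DualFastGradient.dual f g X ubar - f xtilde) / s * (K * √(8 * m * q) / (k + 1)) =
      K * (DualFastGradient.dual f g X ubar - f xtilde) * √(8 * m * q) / ((k + 1) * s) := by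
    field_simp
  rw [he] at hfinal
  linarith
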